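/- Let $t_0,R,\delta\in\mathbb{R}$ with $\delta>1$. There is a constant $C>0$, depending only on $t_0,R,\delta$, with the following property. Let $\phi\in C^2(\mathbb{R}\times\mathbb{R}^2)$ be a real-valued solution of the linear wave equation $-\partial_t^2\phi+\Delta\phi=0$ on $\mathbb{R}^{1,2}=\mathbb{R}\times\mathbb{R}^2$ whose data at time $t_0$ satisfy $\phi(t_0,\cdot)\in C^3(\mathbb{R}^2)$, $\partial_t\phi(t_0,\cdot)\in C^2(\mathbb{R}^2)$ and vanish outside the ball $\{|x|\le R\}$. Write $r=|x|$. Then $\phi(t,x)=0$ whenever $t\ge t_0$ and $r>R+(t-t_0)$, and $$|\phi(t,x)|\le C\,\bigl(\|\phi(t_0,\cdot)\|_{H^3(\mathbb{R}^2)}+\|\partial_t\phi(t_0,\cdot)\|_{H^2(\mathbb{R}^2)}\bigr)\,\frac{\ln[(t+r)(t-r)]}{\sqrt{(t+r)(t-r)}}$$ at all points $(t,x)$ with $t\ge t_0$, $t>r$ and $(t+r)(t-r)\ge\delta$. Here $\|f\|_{H^k}^2=\sum_{j\le k}\int_{\mathbb{R}^2}|D^jf|^2\,dx$, where $|D^jf|$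 is the operator norm of the $j$-th derivative. In particular, for data at time $t_0=2$ supported in the unit ball ($R=1$), the choice $\delta=3$ gives the estimate at every point with $t\ge 2$ and $r\le t-1$, and $\phi=0$ at every point with $t\ge2$ and $r>t-1$. -/

import Mathlib

open MeasureTheory

/-- The Euclidean plane `ℝ²`. -/
abbrev Plane : Type := EuclideanSpace ℝ (Fin 2)

/-- The time derivative `∂_t φ (t, ·)` of a function `φ (t, x)` on `ℝ × ℝ²`. -/
noncomputable def timeDeriv (φ : ℝ → Plane → ℝ) (t : ℝ) : Plane → ℝ :=
  fun x => deriv (fun s => φ s x) t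

/-- The wave operator `□ φ = - ∂_t² φ + Δ φ` of the Minkowski metric `diag (-1, 1, 1)`. -/
noncomputable def waveOp (φ : ℝ → Plane → ℝ) (t : ℝ) (x : Plane) : ℝ :=
  - iteratedDeriv 2 (fun s => φ s x) t + Laplacian.laplacian (φ t) x

/-- `φ` is a classical (that is, `C²`) solution of `□ φ = 0` on `ℝ × ℝ²`. -/
structure IsLinearWave (φ : ℝ → Plane → ℝ) : Prop where
  contDiff : ContDiff ℝ 2 (fun p : ℝ × Plane => φ p.1 p.2)
  waveOp_eq_zero : ∀ t x, waveOp φ t x = 0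

/-- The Sobolev norm of order `k` on `ℝ²`, that is, the square root of the sum over `j ≤ k` of
`∫ |D^j f|²`. It is applied only to functions of class `C^k` with compact support, for which all
the integrals are finite. -/
noncomputable def sobolevNorm (k : ℕ) (f : Plane → ℝ) : ℝ :=
  Real.sqrt (∑ j ∈ Finset.range (k + 1), ∫ x : Plane, ‖iteratedFDeriv ℝ j f x‖ ^ 2)

/-! A plane wave is a wave in three space dimensions that ignores the third coordinate, so
Kirchhoff's formula writes `φ t x` as a mean of the data over a sphere of radius `τ = t - t₀` about
`x`, projected to the plane (`kirchhoff_of_wave`). The projected sphere stays within distance `τ` of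
`x`, which gives finite speed of propagation.

For decay, the Kirchhoff integrand is at most a constant times `1 + τ` times the Sobolev norms, by
the embedding of `H²` in `L^∞` (`norm_le_sqrt_integral_iteratedFDeriv_two_sq`); the gradient of `φ
t₀` costs the third derivative. The integrand lives only over a disc of radius `ρ` about the origin.
By `abs_sphere_integral_le` the part of the sphere above that disc has normalized area of order `ρ²
/ (τ √D)`, where `D = τ² - (r - ρ)²`. The factor `τ` cancels, and for `τ ≥ 4 * ρ` the quantity `D`
controls `(t + r) * (t - r)`; for smaller `τ` everything is bounded.

The outcome is decay like `1 / √((t + r) * (t - r))`, without a logarithm. The stated estimate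
follows because the logarithm is at least `Real.log δ > 0`. -/

/-- The point of the unit disc spanned by `e₁`, `e₂` below the point of the unit sphere with polar
angle `θ` (measured from the axis `e₁`) and azimuth `α`. -/
noncomputable def diskPoint {E : Type*} [AddCommGroup E] [Module ℝ E] (e₁ e₂ : E) (θ α : ℝ) : E :=
  Real.cos θ • e₁ + (Real.sin θ * Real.cos α) • e₂

/-! ### Kirchhoff's formula, by transport along the backward light cone. -/

section Kirchhoff

variable {E : Type*} [NormedAddCommGroup E] [NormedSpace ℝ E]

theorem continuous_diskPoint (e₁ e₂ : E) :
    Continuous fun p : ℝ × ℝ => diskPoint e₁ e₂ p.1 p.2 := by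
  unfold diskPoint; fun_prop

theorem intervalIntegral_swap_of_continuous {F : Type*} [NormedAddCommGroup F] [NormedSpace ℝ F]
    {f : ℝ × ℝ → F} (hf : Continuous f) (a b c d : ℝ) :
    ∫ x in a..b, ∫ y in c..d, f (x, y) = ∫ y in c..d, ∫ x in a..b, f (x, y) := by
  refine intervalIntegral_intervalIntegral_swap (F := fun x y => f (x, y)) ?_
  refine (hf.continuousOn.integrableOn_compact
    (isCompact_uIcc.prod isCompact_uIcc)).mono_set
    (Set.prod_mono Set.uIoc_subset_uIcc Set.uIoc_subset_uIcc)

theorem HasDerivAt.clm_comp_apply {h₁ : E → E →L[ℝ] ℝ} {h₂ : E → E →L[ℝ] E →L[ℝ] ℝ}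
    (hd : ∀ x, HasFDerivAt h₁ (h₂ x) x) {γ v : ℝ → E} {γ' v' : E} {u : ℝ}
    (hγ : HasDerivAt γ γ' u) (hv : HasDerivAt v v' u) :
    HasDerivAt (fun u => h₁ (γ u) (v u)) (h₂ (γ u) γ' (v u) + h₁ (γ u) v') u :=
  ((hd (γ u)).comp_hasDerivAt u hγ).clm_apply hv

/-- The integral over the unit sphere of the spherical Laplacian of a function of two of the three
coordinates vanishes. -/
theorem integral_sphere_laplacian_eq_zero {h₁ : E → E →L[ℝ] ℝ} {h₂ : E → E →L[ℝ] E →L[ℝ] ℝ}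
    (hd : ∀ x, HasFDerivAt h₁ (h₂ x) x) (hc : Continuous h₂)
    (hsymm : ∀ x v w, h₂ x v w = h₂ x w v) (x e₁ e₂ : E) (s : ℝ) :
    ∫ θ in (0 : ℝ)..Real.pi, ∫ α in (0 : ℝ)..Real.pi, Real.sin θ *
      (2 * h₁ (x + s • diskPoint e₁ e₂ θ α) (diskPoint e₁ e₂ θ α) +
        s * (h₂ (x + s • diskPoint e₁ e₂ θ α) (diskPoint e₁ e₂ θ α) (diskPoint e₁ e₂ θ α) -
          (h₂ (x + s • diskPoint e₁ e₂ θ α) e₁ e₁ +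
            h₂ (x + s • diskPoint e₁ e₂ θ α) e₂ e₂))) = 0 := by
  have hc₁ : Continuous h₁ := continuous_iff_continuousAt.2 fun x => (hd x).continuousAt
  have hω := continuous_diskPoint e₁ e₂
  set P : ℝ × ℝ → E := fun p => x + s • diskPoint e₁ e₂ p.1 p.2 with hP
  have hPc : Continuous P := by fun_prop
  -- In polar coordinates `sin θ Δ = ∂_θ (sin θ ∂_θ) + (sin θ)⁻¹ ∂_α²`. Up to the factor `-s`, `A`
  -- and `B` are these two terms applied to the function on the sphere, each already an exact
  -- derivative; `T` and `S` are the velocities of `P` in `θ` and `α`.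
  set V : ℝ × ℝ → E := fun p =>
    Real.sin p.1 • (-Real.sin p.1 • e₁ + (Real.cos p.1 * Real.cos p.2) • e₂) with hV
  set V' : ℝ × ℝ → E := fun p =>
    Real.cos p.1 • (-Real.sin p.1 • e₁ + (Real.cos p.1 * Real.cos p.2) • e₂) +
    Real.sin p.1 • (-Real.cos p.1 • e₁ - (Real.sin p.1 * Real.cos p.2) • e₂) with hV'
  set T : ℝ × ℝ → E := fun p => s • (-Real.sin p.1 • e₁ + (Real.cos p.1 * Real.cos p.2) • e₂)
    with hT
  set S : ℝ × ℝ → E := fun p => (s * (-(Real.sin p.1 * Real.sin p.2))) • e₂ with hS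
  set A : ℝ × ℝ → ℝ := fun p => h₂ (P p) (T p) (V p) + h₁ (P p) (V' p) with hA
  set B : ℝ × ℝ → ℝ := fun p =>
    h₂ (P p) (S p) (-Real.sin p.2 • e₂) + h₁ (P p) (-Real.cos p.2 • e₂) with hB
  have hVc : Continuous V := by fun_prop
  have hVc' : Continuous V' := by fun_prop
  have hTc : Continuous T := by fun_prop
  have hSc : Continuous S := by fun_prop
  have hAc : Continuous A := by fun_prop
  have hBc : Continuous B := by fun_prop
  have dA : ∀ θ α, HasDerivAt (fun θ => h₁ (P (θ, α)) (V (θ, α))) (A (θ, α)) θ := by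
    intro θ α
    have e : HasDerivAt (fun θ => -Real.sin θ • e₁ + (Real.cos θ * Real.cos α) • e₂)
        (-Real.cos θ • e₁ - (Real.sin θ * Real.cos α) • e₂) θ := by
      have := ((Real.hasDerivAt_sin θ).neg.smul_const e₁).add
        (((Real.hasDerivAt_cos θ).mul_const (Real.cos α)).smul_const e₂)
      exact this.congr_deriv (by module)
    refine HasDerivAt.clm_comp_apply hd (γ := fun θ => P (θ, α)) (v := fun θ => V (θ, α))
      ?_ ?_
    · have := ((((Real.hasDerivAt_cos θ).smul_const e₁).add
        (((Real.hasDerivAt_sin θ).mul_const (Real.cos α)).smul_const e₂)).const_smul s).const_add x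
      exact this
    · have := (Real.hasDerivAt_sin θ).smul e
      exact this.congr_deriv (by simp only [hV']; module)
  have dB : ∀ θ α, HasDerivAt (fun α => h₁ (P (θ, α)) (-Real.sin α • e₂)) (B (θ, α)) α := by
    intro θ α
    refine HasDerivAt.clm_comp_apply hd (γ := fun α => P (θ, α)) (v := fun α => -Real.sin α • e₂)
      ?_ ?_
    · have := ((((Real.hasDerivAt_cos α).const_mul (Real.sin θ)).smul_const e₂).const_add
        (Real.cos θ • e₁)).const_smul s |>.const_add x
      exact this.congr_deriv (by simp only [hS]; module)
    · exact (Real.hasDerivAt_sin α).neg.smul_const e₂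
  have key : ∀ θ α, Real.sin θ *
      (2 * h₁ (x + s • diskPoint e₁ e₂ θ α) (diskPoint e₁ e₂ θ α) +
        s * (h₂ (x + s • diskPoint e₁ e₂ θ α) (diskPoint e₁ e₂ θ α) (diskPoint e₁ e₂ θ α) -
          (h₂ (x + s • diskPoint e₁ e₂ θ α) e₁ e₁ +
            h₂ (x + s • diskPoint e₁ e₂ θ α) e₂ e₂))) = -A (θ, α) - B (θ, α) := by
    intro θ α
    change Real.sin θ * (2 * h₁ (P (θ, α)) _ + s * (h₂ (P (θ, α)) _ _ -
      (h₂ (P (θ, α)) _ _ + h₂ (P (θ, α)) _ _))) = _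
    simp only [hA, hB, hT, hV, hV', hS, diskPoint, map_add, map_sub, map_smul, map_neg, neg_smul,
      add_apply, smul_apply,
      neg_apply, smul_eq_mul]
    rw [hsymm (P (θ, α)) e₂ e₁]
    generalize h₂ (P (θ, α)) e₁ e₁ = a
    generalize h₂ (P (θ, α)) e₁ e₂ = b
    generalize h₂ (P (θ, α)) e₂ e₂ = c
    generalize h₁ (P (θ, α)) e₁ = k
    generalize h₁ (P (θ, α)) e₂ = l
    have h1 := Real.sin_sq_add_cos_sq θ
    have h2 := Real.sin_sq_add_cos_sq α
    generalize Real.sin θ = p at *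
    generalize Real.cos θ = q at *
    generalize Real.sin α = m at *
    generalize Real.cos α = n at *
    obtain hq : q ^ 2 = 1 - p ^ 2 := by linarith
    obtain hm : m ^ 2 = 1 - n ^ 2 := by linarith
    linear_combination (l * n + s * p * n ^ 2 * c + s * p * a) * hq + s * p * c * hm
  simp_rw [key]
  -- Half the azimuth range suffices: symmetry in the third coordinate puts the factor `sin α` in
  -- the primitive, and it vanishes at both ends. In `θ`, the factor `sin θ` of `V` plays the same
  -- role.
  have hBint : ∀ θ, ∫ α in (0 : ℝ)..Real.pi, B (θ, α) = 0 := by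
    intro θ
    rw [intervalIntegral.integral_eq_sub_of_hasDerivAt (fun α _ => dB θ α)
      (Continuous.intervalIntegrable (by fun_prop) _ _)]
    simp
  have hAint : ∀ α, ∫ θ in (0 : ℝ)..Real.pi, A (θ, α) = 0 := by
    intro α
    rw [intervalIntegral.integral_eq_sub_of_hasDerivAt (fun θ _ => dA θ α)
      (Continuous.intervalIntegrable (by fun_prop) _ _)]
    simp [hV]
  have : ∀ θ, ∫ α in (0 : ℝ)..Real.pi, (-A (θ, α) - B (θ, α)) =
      -∫ α in (0 : ℝ)..Real.pi, A (θ, α) := by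
    intro θ
    rw [intervalIntegral.integral_sub (Continuous.intervalIntegrable (by fun_prop) _ _)
      (Continuous.intervalIntegrable (by fun_prop) _ _), hBint, intervalIntegral.integral_neg,
      sub_zero]
  simp_rw [this]
  rw [intervalIntegral.integral_neg, intervalIntegral_swap_of_continuous hAc]
  simp [hAint]

/-- Kirchhoff's formula for solutions that do not depend on the third space coordinate. -/
theorem kirchhoff_of_wave {Φ : ℝ × E → ℝ} {Φ₁ : ℝ × E → ℝ × E →L[ℝ] ℝ}
    {Φ₂ : ℝ × E → ℝ × E →L[ℝ] ℝ × E →L[ℝ] ℝ}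
    (hd : ∀ p, HasFDerivAt Φ (Φ₁ p) p) (hd₁ : ∀ p, HasFDerivAt Φ₁ (Φ₂ p) p)
    (hc : Continuous Φ₂) (hsymm : ∀ p v w, Φ₂ p v w = Φ₂ p w v) (e₁ e₂ : E)
    (hwave : ∀ p, Φ₂ p (1, 0) (1, 0) = Φ₂ p (0, e₁) (0, e₁) + Φ₂ p (0, e₂) (0, e₂))
    (t τ : ℝ) (x : E) :
    2 * Real.pi * Φ (t, x) =
      ∫ θ in (0 : ℝ)..Real.pi, ∫ α in (0 : ℝ)..Real.pi, Real.sin θ *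
        (Φ (t - τ, x + τ • diskPoint e₁ e₂ θ α) +
          τ * Φ₁ (t - τ, x + τ • diskPoint e₁ e₂ θ α) (1, diskPoint e₁ e₂ θ α)) := by
  have hc₁ : Continuous Φ₁ := continuous_iff_continuousAt.2 fun x => (hd₁ x).continuousAt
  have hc₀ : Continuous Φ := continuous_iff_continuousAt.2 fun x => (hd x).continuousAt
  have hω := continuous_diskPoint e₁ e₂
  set ω : ℝ × ℝ → E := fun p => diskPoint e₁ e₂ p.1 p.2 with hω'
  -- `s` moves down the backward light cone from `(t, x)`. The sphere integral of `F s` turns out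
  -- not to depend on `s`; it is `2 * Real.pi * Φ (t, x)` at `s = 0` and the Kirchhoff integral at
  -- `s = τ`.
  set F : ℝ → ℝ × ℝ → ℝ := fun s p => Real.sin p.1 *
    (Φ (t - s, x + s • ω p) + s * Φ₁ (t - s, x + s • ω p) (1, ω p)) with hF
  set F' : ℝ → ℝ × ℝ → ℝ := fun s p => Real.sin p.1 *
    (Φ₁ (t - s, x + s • ω p) (-1, ω p) + (Φ₁ (t - s, x + s • ω p) (1, ω p) +
      s * Φ₂ (t - s, x + s • ω p) (-1, ω p) (1, ω p))) with hF'
  have dF : ∀ p s, HasDerivAt (fun s => F s p) (F' s p) s := by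
    intro p s
    have hγ : HasDerivAt (fun s => (t - s, x + s • ω p)) ((-1 : ℝ), ω p) s := by
      refine HasDerivAt.prodMk ?_ ?_
      · exact (hasDerivAt_id s).const_sub t
      · simpa using ((hasDerivAt_id s).smul_const (ω p)).const_add x
    have h1 := (hd _).comp_hasDerivAt s hγ
    have h2 := HasDerivAt.clm_comp_apply hd₁ hγ (hasDerivAt_const s ((1 : ℝ), ω p))
    have := (h1.add ((hasDerivAt_id s).mul h2)).const_mul (Real.sin p.1)
    exact this.congr_deriv (by simp only [hF', map_zero, add_zero, id, one_mul])
  have hzero : ∀ s, ∫ θ in (0 : ℝ)..Real.pi, ∫ α in (0 : ℝ)..Real.pi, F' s (θ, α) = 0 := by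
    intro s
    have := integral_sphere_laplacian_eq_zero hd₁ hc hsymm (t - s, x) (0, e₁) (0, e₂) s
    rw [← this]
    congr! 4 with θ α
    have e1 : diskPoint ((0 : ℝ), e₁) ((0 : ℝ), e₂) θ α = (0, ω (θ, α)) := by
      simp [diskPoint, hω']
    rw [e1]
    have e2 : (t - s, x) + s • ((0 : ℝ), ω (θ, α)) = (t - s, x + s • ω (θ, α)) := by simp
    rw [e2, ← hwave]
    -- Expanding `(-1, ω)` and `(1, ω)`, the mixed second derivatives cancel by symmetry and the
    -- pure time derivative becomes the plane Laplacian, so `F'` is the integrand of the spherical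
    -- Laplacian lemma.
    have e3 : ((-1 : ℝ), ω (θ, α)) = (0, ω (θ, α)) - (1, 0) := by simp
    have e4 : ((1 : ℝ), ω (θ, α)) = (0, ω (θ, α)) + (1, 0) := by simp
    simp only [hF', e3, e4, map_add, map_sub, sub_apply]
    rw [hsymm _ (1, 0) (0, ω (θ, α))]
    ring
  have hdiff : ∀ θ α, F τ (θ, α) - F 0 (θ, α) = ∫ s in (0 : ℝ)..τ, F' s (θ, α) := by
    intro θ α
    rw [intervalIntegral.integral_eq_sub_of_hasDerivAt (fun s _ => dF (θ, α) s)
      (Continuous.intervalIntegrable (by fun_prop) _ _)]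
  have hsw : ∫ θ in (0 : ℝ)..Real.pi, ∫ α in (0 : ℝ)..Real.pi, ∫ s in (0 : ℝ)..τ, F' s (θ, α)
      = 0 := by
    have h1 : ∀ θ, ∫ α in (0 : ℝ)..Real.pi, ∫ s in (0 : ℝ)..τ, F' s (θ, α) =
        ∫ s in (0 : ℝ)..τ, ∫ α in (0 : ℝ)..Real.pi, F' s (θ, α) := fun θ =>
      intervalIntegral_swap_of_continuous (f := fun q : ℝ × ℝ => F' q.2 (θ, q.1)) (by fun_prop)
        _ _ _ _
    simp_rw [h1]
    have h2 : Continuous fun q : ℝ × ℝ => ∫ α in (0 : ℝ)..Real.pi, F' q.2 (q.1, α) :=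
      intervalIntegral.continuous_parametric_intervalIntegral_of_continuous'
        (f := fun (q : ℝ × ℝ) α => F' q.2 (q.1, α)) (by unfold Function.uncurry; fun_prop) _ _
    rw [intervalIntegral_swap_of_continuous h2]
    simp [hzero]
  have cFi : ∀ s, Continuous fun θ : ℝ => ∫ α in (0 : ℝ)..Real.pi, F s (θ, α) := fun s =>
      intervalIntegral.continuous_parametric_intervalIntegral_of_continuous'
        (f := fun θ α => F s (θ, α)) (by unfold Function.uncurry; fun_prop) _ _
  have h0 : ∫ θ in (0 : ℝ)..Real.pi, ∫ α in (0 : ℝ)..Real.pi, F 0 (θ, α) =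
      2 * Real.pi * Φ (t, x) := by
    simp only [hF, zero_mul, add_zero, sub_zero, zero_smul, intervalIntegral.integral_const,
      smul_eq_mul, intervalIntegral.integral_const_mul, intervalIntegral.integral_mul_const,
      integral_sin, Real.cos_zero, Real.cos_pi]
    ring
  have hfin : ∫ θ in (0 : ℝ)..Real.pi, ∫ α in (0 : ℝ)..Real.pi, (F τ (θ, α) - F 0 (θ, α)) = 0 := by
    simp_rw [hdiff]; exact hsw
  have : ∀ θ, ∫ α in (0 : ℝ)..Real.pi, (F τ (θ, α) - F 0 (θ, α)) =
      (∫ α in (0 : ℝ)..Real.pi, F τ (θ, α)) - ∫ α in (0 : ℝ)..Real.pi, F 0 (θ, α) := fun θ =>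
    intervalIntegral.integral_sub (Continuous.intervalIntegrable (by fun_prop) _ _)
      (Continuous.intervalIntegrable (by fun_prop) _ _)
  simp_rw [this] at hfin
  rw [intervalIntegral.integral_sub ((cFi τ).intervalIntegrable _ _)
    ((cFi 0).intervalIntegrable _ _), h0, sub_eq_zero] at hfin
  exact hfin.symm

end Kirchhoff

/-! ### Sup bounds for the data by their Sobolev norms. -/

section Sobolev

theorem norm_fderiv_fderiv_apply_le {E F : Type*} [NormedAddCommGroup E] [NormedSpace ℝ E]
    [NormedAddCommGroup F] [NormedSpace ℝ F] (h : E → F) (x v w : E) :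
    ‖fderiv ℝ (fderiv ℝ h) x v w‖ ≤ ‖iteratedFDeriv ℝ 2 h x‖ * ‖v‖ * ‖w‖ := by
  rw [← norm_iteratedFDeriv_fderiv, ← norm_iteratedFDeriv_fderiv, norm_iteratedFDeriv_zero]
  exact ContinuousLinearMap.le_opNorm₂ _ _ _

theorem fderiv_eq_zero_of_support_subset_closedBall {E F : Type*} [NormedAddCommGroup E]
    [NormedSpace ℝ E] [NormedAddCommGroup F] [NormedSpace ℝ F] {h : E → F} {R : ℝ}
    (hs : Function.support h ⊆ Metric.closedBall 0 R) {x : E} (hx : R < ‖x‖) :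
    fderiv ℝ h x = 0 := by
  have : x ∉ tsupport h := fun hm => by
    have := closure_minimal hs Metric.isClosed_closedBall hm
    rw [mem_closedBall_zero_iff] at this
    exact absurd this (not_le.2 hx)
  exact Function.notMem_support.1 fun h' => this (support_fderiv_subset ℝ h')

theorem support_fderiv_subset_closedBall {E F : Type*} [NormedAddCommGroup E]
    [NormedSpace ℝ E] [NormedAddCommGroup F] [NormedSpace ℝ F] {h : E → F} {R : ℝ}
    (hs : Function.support h ⊆ Metric.closedBall 0 R) :
    Function.support (fderiv ℝ h) ⊆ Metric.closedBall 0 R := fun x hx => by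
  by_contra hn
  rw [mem_closedBall_zero_iff, not_le] at hn
  exact hx (fderiv_eq_zero_of_support_subset_closedBall hs hn)

/-- The Cauchy-Schwarz inequality on a ball. -/
theorem integral_le_sqrt_volume_mul_sqrt_integral_sq {E : Type*} [NormedAddCommGroup E]
    [MeasurableSpace E] [BorelSpace E] [ProperSpace E] (μ : Measure E)
    [IsFiniteMeasureOnCompacts μ] {G : E → ℝ} (hG : Continuous G)
    (h0 : ∀ x, 0 ≤ G x) {R : ℝ} (hs : Function.support G ⊆ Metric.closedBall 0 R) :
    ∫ x, G x ∂μ ≤ √(μ.real (Metric.closedBall 0 R)) * √(∫ x, G x ^ 2 ∂μ) := by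
  have hcs : HasCompactSupport G :=
    HasCompactSupport.of_support_subset_isCompact (isCompact_closedBall 0 R) hs
  have hfin : μ (Metric.closedBall 0 R) ≠ ⊤ := (isCompact_closedBall (0 : E) R).measure_lt_top.ne
  -- Writing `G` as the indicator of the ball times `G` makes Hölder with exponents 2, 2 produce the
  -- volume factor.
  have h1 : ∀ x, G x = (Metric.closedBall (0 : E) R).indicator (fun _ => (1 : ℝ)) x * G x := by
    intro x
    by_cases hx : x ∈ Metric.closedBall (0 : E) R
    · simp [hx]
    · simp [hx, Function.notMem_support.1 fun h => hx (hs h)]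
  have key := integral_mul_le_Lp_mul_Lq_of_nonneg (μ := μ) Real.HolderConjugate.two_two
    (f := (Metric.closedBall (0 : E) R).indicator (fun _ => (1 : ℝ))) (g := G)
    (Filter.Eventually.of_forall fun x => Set.indicator_nonneg (fun _ _ => zero_le_one) x)
    (Filter.Eventually.of_forall h0)
    (memLp_indicator_const _ Metric.isClosed_closedBall.measurableSet _ (Or.inr hfin))
    (hG.memLp_of_hasCompactSupport hcs)
  rw [integral_congr_ae (Filter.Eventually.of_forall h1)]
  refine key.trans_eq ?_
  rw [Real.sqrt_eq_rpow, Real.sqrt_eq_rpow]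
  simp only [Real.rpow_two]
  congr 2
  have : (fun a => (Metric.closedBall (0 : E) R).indicator (fun _ => (1 : ℝ)) a ^ 2) =
      (Metric.closedBall (0 : E) R).indicator (fun _ => (1 : ℝ)) := by
    ext a
    by_cases ha : a ∈ Metric.closedBall (0 : E) R <;> simp [ha]
  rw [this, integral_indicator_const _ Metric.isClosed_closedBall.measurableSet]
  simp

theorem integral_prod_eq_integral_plane {F : Type*} [NormedAddCommGroup F] [NormedSpace ℝ F]
    (G : Plane → F) : ∫ p : ℝ × ℝ, G !₂[p.1, p.2] = ∫ x, G x := by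
  have h1 := (volume_preserving_finTwoArrow ℝ).symm
  have h2 := (EuclideanSpace.volume_preserving_symm_measurableEquiv_toLp (Fin 2)).symm
  rw [← h2.integral_comp (MeasurableEquiv.measurableEmbedding _) G,
    ← h1.integral_comp (MeasurableEquiv.measurableEmbedding _)]
  rfl

/-- The embedding of `H²` into `L^∞` in two dimensions, for functions supported in a fixed ball. -/
theorem norm_le_sqrt_integral_iteratedFDeriv_two_sq {F : Type*} [NormedAddCommGroup F]
    [NormedSpace ℝ F] [CompleteSpace F] {h : Plane → F} (hh : ContDiff ℝ 2 h) {R : ℝ}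
    (hs : Function.support h ⊆ Metric.closedBall 0 R) (x : Plane) :
    ‖h x‖ ≤ √(volume.real (Metric.closedBall (0 : Plane) R)) *
      √(∫ y, ‖iteratedFDeriv ℝ 2 h y‖ ^ 2) := by
  have hh₁ : ContDiff ℝ 1 (fderiv ℝ h) := hh.fderiv_right (by norm_num)
  have hc₁ : Continuous (fderiv ℝ h) := hh₁.continuous
  have hc₂ : Continuous (fderiv ℝ (fderiv ℝ h)) := hh₁.continuous_fderiv one_ne_zero
  have hd : ∀ y, HasFDerivAt h (fderiv ℝ h y) y := fun y =>
    (hh.differentiable two_ne_zero y).hasFDerivAt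
  have hd₁ : ∀ y, HasFDerivAt (fderiv ℝ h) (fderiv ℝ (fderiv ℝ h) y) y := fun y =>
    (hh₁.differentiable one_ne_zero y).hasFDerivAt
  have hs₁ := support_fderiv_subset_closedBall hs
  set G : Plane → ℝ := fun y => ‖iteratedFDeriv ℝ 2 h y‖ with hG
  have hGc : Continuous G := (hh.continuous_iteratedFDeriv le_rfl).norm
  have hGs : Function.support G ⊆ Metric.closedBall 0 R := by
    intro y hy
    exact closure_minimal hs Metric.isClosed_closedBall (support_iteratedFDeriv_subset (𝕜 := ℝ) 2
      (fun h0 => hy (by simp only [hG, h0, norm_zero])))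
  have hGn : ∀ y v w, ‖fderiv ℝ (fderiv ℝ h) y v w‖ ≤ G y * ‖v‖ * ‖w‖ :=
    norm_fderiv_fderiv_apply_le h
  set h₁ := fderiv ℝ h
  set h₂ := fderiv ℝ h₁
  refine le_trans ?_ (integral_le_sqrt_volume_mul_sqrt_integral_sq volume hGc
    (fun y => norm_nonneg _) hGs)
  set e₁ : Plane := EuclideanSpace.single 0 1 with he₁
  set e₂ : Plane := EuclideanSpace.single 1 1 with he₂
  have hn₁ : ‖e₁‖ = 1 := by simp [he₁]
  have hn₂ : ‖e₂‖ = 1 := by simp [he₂]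
  have hP : ∀ a b : ℝ, (!₂[a, b] : Plane) = a • e₁ + b • e₂ := by
    intro a b
    ext i
    fin_cases i <;> simp [he₁, he₂]
  -- The box `[-M, M]²` contains `x`, and `h`, `h₁` vanish on its left and lower sides. Hence `h x`
  -- is the integral of the mixed derivative `∂₁∂₂ h` over the part of the box to the lower left of
  -- `x`.
  set M : ℝ := |R| + |x 0| + |x 1| + 1 with hM
  have hR := le_abs_self R
  have hx0 := abs_nonneg (x 0)
  have hx1 := abs_nonneg (x 1)
  have hR0 := abs_nonneg R
  have hM0 : 0 < M := by positivity
  have hMR : R < M := by linarith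
  have hcoord : ∀ (y : Plane) (i : Fin 2), |y i| ≤ ‖y‖ := fun y i => PiLp.norm_apply_le y i
  have hz₀ : ∀ b, h !₂[-M, b] = 0 := fun b => by
    by_contra hne
    have h3 := mem_closedBall_zero_iff.1 (hs hne)
    have h4 := hcoord !₂[-M, b] 0
    simp [abs_of_pos hM0] at h4
    linarith
  have hz₁ : ∀ a, h₁ !₂[a, -M] = 0 := fun a => by
    by_contra hne
    have h3 := mem_closedBall_zero_iff.1 (hs₁ hne)
    have h4 := hcoord !₂[a, -M] 1
    simp [abs_of_pos hM0] at h4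
    linarith
  have hmk : Continuous fun p : ℝ × ℝ => (!₂[p.1, p.2] : Plane) := by
    simp only [hP]; fun_prop
  have d₀ : ∀ a b, HasDerivAt (fun a => h !₂[a, b]) (h₁ !₂[a, b] e₁) a := fun a b => by
    refine (hd _).comp_hasDerivAt a ?_
    simp only [hP]
    simpa using ((hasDerivAt_id a).smul_const e₁).add_const (b • e₂)
  have d₁ : ∀ a b, HasDerivAt (fun b => h₁ !₂[a, b] e₁) (h₂ !₂[a, b] e₂ e₁) b := fun a b => by
    have : HasDerivAt (fun b => h₁ !₂[a, b]) (h₂ !₂[a, b] e₂) b := by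
      refine (hd₁ _).comp_hasDerivAt b ?_
      simp only [hP]
      simpa using ((hasDerivAt_id b).smul_const e₂).const_add (a • e₁)
    simpa using this.clm_apply (hasDerivAt_const b e₁)
  have cG : Continuous fun p : ℝ × ℝ => G !₂[p.1, p.2] := hGc.comp hmk
  have c1 : Continuous fun p : ℝ × ℝ => h₁ !₂[p.1, p.2] e₁ := (hc₁.comp hmk).clm_apply (by fun_prop)
  have c2 : Continuous fun p : ℝ × ℝ => h₂ !₂[p.1, p.2] e₂ e₁ :=
    ((hc₂.comp hmk).clm_apply (by fun_prop)).clm_apply (by fun_prop)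
  have b1 : ∀ a, ‖h₁ !₂[a, x 1] e₁‖ ≤ ∫ b in (-M)..M, G !₂[a, b] := by
    intro a
    have i1 := intervalIntegral.integral_eq_sub_of_hasDerivAt (a := -M) (b := x 1)
      (fun b _ => d₁ a b) (Continuous.intervalIntegrable
        (c2.comp (f := fun b => (a, b)) (by fun_prop)) _ _)
    rw [hz₁] at i1
    have hle : -M ≤ x 1 := by linarith [neg_abs_le (x 1)]
    have hle' : x 1 ≤ M := by linarith [le_abs_self (x 1)]
    have : h₁ !₂[a, x 1] e₁ = ∫ b in (-M)..x 1, h₂ !₂[a, b] e₂ e₁ := by rw [i1]; simp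
    rw [this]
    have iG : ∀ c d, IntervalIntegrable (fun b => G !₂[a, b]) volume c d := fun c d =>
      Continuous.intervalIntegrable (cG.comp (f := fun b => (a, b)) (by fun_prop)) _ _
    refine (intervalIntegral.norm_integral_le_of_norm_le hle
      (Filter.Eventually.of_forall fun b _ => ?_) (iG _ _)).trans
      (intervalIntegral.integral_mono_interval le_rfl hle hle'
        (Filter.Eventually.of_forall fun b => norm_nonneg _) (iG _ _))
    simpa [hn₁, hn₂] using hGn !₂[a, b] e₂ e₁
  have b0 : ‖h x‖ ≤ ∫ a in (-M)..M, ∫ b in (-M)..M, G !₂[a, b] := by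
    have i1 := intervalIntegral.integral_eq_sub_of_hasDerivAt (a := -M) (b := x 0)
      (fun a _ => d₀ a (x 1)) (Continuous.intervalIntegrable
        (c1.comp (f := fun a => (a, x 1)) (by fun_prop)) _ _)
    rw [hz₀, sub_zero] at i1
    have hle : -M ≤ x 0 := by linarith [neg_abs_le (x 0)]
    have hle' : x 0 ≤ M := by linarith [le_abs_self (x 0)]
    have hx : h x = ∫ a in (-M)..x 0, h₁ !₂[a, x 1] e₁ := by
      rw [i1]
      congr 1
      ext i
      fin_cases i <;> simp
    rw [hx]
    have iG : ∀ c d, IntervalIntegrable (fun a => ∫ b in (-M)..M, G !₂[a, b]) volume c d :=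
      fun c d => Continuous.intervalIntegrable
        (intervalIntegral.continuous_parametric_intervalIntegral_of_continuous'
          (f := fun a b => G !₂[a, b]) cG _ _) _ _
    refine (intervalIntegral.norm_integral_le_of_norm_le hle
      (Filter.Eventually.of_forall fun a _ => b1 a) (iG _ _)).trans
      (intervalIntegral.integral_mono_interval le_rfl hle hle'
        (Filter.Eventually.of_forall fun a => intervalIntegral.integral_nonneg (by linarith)
          fun b _ => norm_nonneg _) (iG _ _))
  have hGcs : HasCompactSupport fun p : ℝ × ℝ => G !₂[p.1, p.2] := by
    refine HasCompactSupport.of_support_subset_isCompact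
      (isCompact_Icc.prod isCompact_Icc : IsCompact (Set.Icc (-R) R ×ˢ Set.Icc (-R) R)) ?_
    intro p hp
    have h3 := mem_closedBall_zero_iff.1 (hGs hp)
    have h4 := (hcoord !₂[p.1, p.2] 0).trans h3
    have h5 := (hcoord !₂[p.1, p.2] 1).trans h3
    simp only [Matrix.cons_val_zero, Matrix.cons_val_one] at h4 h5
    exact ⟨abs_le.1 h4, abs_le.1 h5⟩
  have hint : Integrable (fun p : ℝ × ℝ => G !₂[p.1, p.2]) := cG.integrable_of_hasCompactSupport hGcs
  refine b0.trans ?_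
  rw [← integral_prod_eq_integral_plane]
  have hMM : -M ≤ M := by linarith
  simp only [intervalIntegral.integral_of_le hMM]
  rw [Measure.volume_eq_prod] at hint ⊢
  rw [← setIntegral_prod (fun p : ℝ × ℝ => G !₂[p.1, p.2])]
  · exact setIntegral_le_integral hint (Filter.Eventually.of_forall fun p => norm_nonneg _)
  · exact hint.integrableOn

theorem sqrt_integral_le_sobolevNorm {j k : ℕ} (hjk : j ≤ k) (f : Plane → ℝ) :
    √(∫ x, ‖iteratedFDeriv ℝ j f x‖ ^ 2) ≤ sobolevNorm k f := by
  refine Real.sqrt_le_sqrt ?_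
  exact Finset.single_le_sum (f := fun j => ∫ x : Plane, ‖iteratedFDeriv ℝ j f x‖ ^ 2)
    (fun i _ => integral_nonneg fun x => by positivity) (Finset.mem_range.2 (by lia))

theorem abs_le_sobolevNorm {k : ℕ} (hk : 2 ≤ k) {f : Plane → ℝ} (hf : ContDiff ℝ 2 f) {R : ℝ}
    (hs : Function.support f ⊆ Metric.closedBall 0 R) (x : Plane) :
    |f x| ≤ √(volume.real (Metric.closedBall (0 : Plane) R)) * sobolevNorm k f :=
  (norm_le_sqrt_integral_iteratedFDeriv_two_sq hf hs x).trans
    (mul_le_mul_of_nonneg_left (sqrt_integral_le_sobolevNorm hk f) (Real.sqrt_nonneg _))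

/-- The sup bound applied to the vector-valued map `fderiv ℝ f`, whose second derivative has the
norm of the third derivative of `f`. -/
theorem norm_fderiv_le_sobolevNorm {k : ℕ} (hk : 3 ≤ k) {f : Plane → ℝ} (hf : ContDiff ℝ 3 f)
    {R : ℝ} (hs : Function.support f ⊆ Metric.closedBall 0 R) (x : Plane) :
    ‖fderiv ℝ f x‖ ≤ √(volume.real (Metric.closedBall (0 : Plane) R)) * sobolevNorm k f := by
  refine (norm_le_sqrt_integral_iteratedFDeriv_two_sq (hf.fderiv_right (by norm_num))
    (support_fderiv_subset_closedBall hs) x).trans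
    (mul_le_mul_of_nonneg_left ?_ (Real.sqrt_nonneg _))
  simp only [norm_iteratedFDeriv_fderiv]
  exact sqrt_integral_le_sobolevNorm hk f

end Sobolev

/-! ### The area of a sphere above a small disc. -/

section SphereMeasure

/-- Domination by `B` times the indicator of `Icc p q`. This interval may stick out of `Icc a b`, so
angular windows need no truncation. -/
theorem abs_integral_le_of_eq_zero_off_Icc {k : ℝ → ℝ} {a b p q B : ℝ} (hab : a ≤ b) (hpq : p ≤ q)
    (hB : 0 ≤ B) (hk : ∀ x ∈ Set.Icc a b, |k x| ≤ B)
    (h0 : ∀ x ∈ Set.Icc a b, k x ≠ 0 → x ∈ Set.Icc p q) :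
    |∫ x in a..b, k x| ≤ B * (q - p) := by
  rw [intervalIntegral.integral_of_le hab, ← Real.norm_eq_abs]
  have hi : Integrable ((Set.Icc p q).indicator fun _ => B) (volume : Measure ℝ) :=
    (integrable_indicator_iff measurableSet_Icc).2 continuous_const.integrableOn_Icc
  refine (norm_integral_le_of_norm_le (hi.restrict (s := Set.Ioc a b)) ?_).trans ?_
  · refine (ae_restrict_iff' measurableSet_Ioc).2 (Filter.Eventually.of_forall fun x hx => ?_)
    have hx' := Set.Ioc_subset_Icc_self hx
    by_cases hkx : k x = 0
    · rw [hkx, norm_zero]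
      exact Set.indicator_nonneg (fun _ _ => hB) x
    · rw [Set.indicator_of_mem (h0 x hx' hkx)]
      exact hk x hx'
  · refine (setIntegral_le_integral hi
      (Filter.Eventually.of_forall fun x => Set.indicator_nonneg (fun _ _ => hB) x)).trans_eq ?_
    rw [integral_indicator_const _ measurableSet_Icc]
    simp [Measure.real, hpq, mul_comm]

/-- Jordan's inequality for the sine of `π / 2 - α`. -/
theorem mem_Icc_of_abs_cos_le {α c : ℝ} (hα : α ∈ Set.Icc 0 Real.pi) (hc : |Real.cos α| ≤ c) :
    α ∈ Set.Icc (Real.pi / 2 - Real.pi / 2 * c) (Real.pi / 2 + Real.pi / 2 * c) := by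
  have h1 := Real.mul_abs_le_abs_sin (x := Real.pi / 2 - α)
    (abs_le.2 ⟨by linarith [hα.2], by linarith [hα.1]⟩)
  rw [Real.sin_pi_div_two_sub] at h1
  have h2 : |Real.pi / 2 - α| ≤ Real.pi / 2 * c := by
    have h3 := mul_le_mul_of_nonneg_left (h1.trans hc) (by positivity : 0 ≤ Real.pi / 2)
    have hpi := Real.pi_ne_zero
    calc |Real.pi / 2 - α| = Real.pi / 2 * (2 / Real.pi * |Real.pi / 2 - α|) := by field_simp
      _ ≤ _ := h3
  rw [abs_le] at h2
  exact ⟨by linarith [h2.2], by linarith [h2.1]⟩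

/-- The difference of cosines is twice the product of the sines of the mean angle and of half the
gap. Jordan's inequality bounds the second sine below; the first is at least `sin θ' / 2`, since
`sin θ ≥ 0`. This turns a bound on heights into a bound on polar angles. -/
theorem sin_mul_sub_le_pi_mul_cos_sub_cos {θ θ' : ℝ} (h0 : 0 ≤ θ) (hle : θ ≤ θ')
    (hpi : θ' ≤ Real.pi) :
    Real.sin θ' * (θ' - θ) ≤ Real.pi * (Real.cos θ - Real.cos θ') := by
  have hp := Real.pi_pos
  have h1 : 2 / Real.pi * ((θ' - θ) / 2) ≤ Real.sin ((θ' - θ) / 2) :=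
    Real.mul_le_sin (by linarith) (by linarith)
  have h1' : θ' - θ ≤ Real.pi * Real.sin ((θ' - θ) / 2) := by
    have := mul_le_mul_of_nonneg_left h1 hp.le
    calc θ' - θ = Real.pi * (2 / Real.pi * ((θ' - θ) / 2)) := by field_simp
      _ ≤ _ := this
  have h2 : 0 ≤ Real.sin ((θ' + θ) / 2) :=
    Real.sin_nonneg_of_nonneg_of_le_pi (by linarith) (by linarith)
  have h3 : 0 ≤ Real.sin θ := Real.sin_nonneg_of_nonneg_of_le_pi h0 (by linarith)
  have h3' : 0 ≤ Real.sin θ' := Real.sin_nonneg_of_nonneg_of_le_pi (by linarith) hpi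
  have h4 : Real.sin θ' + Real.sin θ = 2 * Real.sin ((θ' + θ) / 2) * Real.cos ((θ' - θ) / 2) := by
    have := Real.sin_add ((θ' + θ) / 2) ((θ' - θ) / 2)
    have h' := Real.sin_sub ((θ' + θ) / 2) ((θ' - θ) / 2)
    rw [show (θ' + θ) / 2 + (θ' - θ) / 2 = θ' by ring] at this
    rw [show (θ' + θ) / 2 - (θ' - θ) / 2 = θ by ring] at h'
    rw [this, h']; ring
  have h5 : Real.cos θ - Real.cos θ' =
      2 * Real.sin ((θ' + θ) / 2) * Real.sin ((θ' - θ) / 2) := by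
    rw [Real.cos_sub_cos, show (θ + θ') / 2 = (θ' + θ) / 2 by ring,
      show (θ - θ') / 2 = -((θ' - θ) / 2) by ring, Real.sin_neg]
    ring
  have h6 : Real.sin θ' ≤ 2 * Real.sin ((θ' + θ) / 2) := by
    have := mul_le_mul_of_nonneg_left (Real.cos_le_one ((θ' - θ) / 2)) h2
    linarith
  rw [h5]
  calc Real.sin θ' * (θ' - θ) ≤ 2 * Real.sin ((θ' + θ) / 2) *
        (Real.pi * Real.sin ((θ' - θ) / 2)) :=
        mul_le_mul h6 h1' (by linarith) (by linarith)
    _ = _ := by ring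

/-- The part of a sphere of radius `τ` which lies over a disc of radius `ρ` whose centre has
distance `r` from the centre of the sphere is small. -/
theorem abs_sphere_integral_le {K : ℝ → ℝ → ℝ} {B τ r ρ : ℝ} (hB : 0 ≤ B) (hρ : 0 < ρ)
    (hτ : ρ < τ) (hr : 0 ≤ r) (hcone : 0 < τ - r + ρ)
    (hK : ∀ θ α, |K θ α| ≤ B)
    (hsupp : ∀ θ α, K θ α ≠ 0 →
      |τ * Real.cos θ - r| ≤ ρ ∧ |τ * (Real.sin θ * Real.cos α)| ≤ ρ) :
    |∫ θ in (0 : ℝ)..Real.pi, ∫ α in (0 : ℝ)..Real.pi, Real.sin θ * K θ α| ≤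
      B * (Real.pi * ρ / τ) * (2 * Real.pi * ρ / √((τ - r + ρ) * (τ + r - ρ))) := by
  have hpi := Real.pi_pos
  have hτ0 : 0 < τ := hρ.trans hτ
  have hD : 0 < (τ - r + ρ) * (τ + r - ρ) := mul_pos hcone (by linarith)
  set D := (τ - r + ρ) * (τ + r - ρ) with hDdef
  -- `a` is the least `cos θ` allowed on the support, so `Real.arccos a` is the largest polar angle.
  set a := (r - ρ) / τ with ha
  have haτ : a * τ = r - ρ := by rw [ha]; field_simp
  have ha1 : a < 1 := by rw [ha, div_lt_one hτ0]; linarith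
  have ha2 : -1 < a := by rw [ha, lt_div_iff₀ hτ0]; linarith
  have hsin : τ * Real.sin (Real.arccos a) = √D := by
    rw [Real.sin_arccos, eq_comm, Real.sqrt_eq_iff_mul_self_eq hD.le (by positivity), eq_comm]
    have := Real.mul_self_sqrt (show 0 ≤ 1 - a ^ 2 by nlinarith)
    calc τ * √(1 - a ^ 2) * (τ * √(1 - a ^ 2)) = τ ^ 2 * (√(1 - a ^ 2) * √(1 - a ^ 2)) := by ring
      _ = τ ^ 2 - (a * τ) ^ 2 := by rw [this]; ring
      _ = D := by rw [haτ, hDdef]; ring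
  have hsD : 0 < √D := Real.sqrt_pos.2 hD
  have inner : ∀ θ ∈ Set.Icc 0 Real.pi,
      |∫ α in (0 : ℝ)..Real.pi, Real.sin θ * K θ α| ≤ B * (Real.pi * ρ / τ) := by
    intro θ hθ
    rw [intervalIntegral.integral_const_mul, abs_mul,
      abs_of_nonneg (Real.sin_nonneg_of_mem_Icc hθ)]
    rcases (Real.sin_nonneg_of_mem_Icc hθ).eq_or_lt with h0 | h0
    · rw [← h0, zero_mul]; positivity
    -- The azimuth window has length `π * c`; the weight `sin θ` cancels the singularity of `c` at
    -- the poles.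
    · set c := ρ / (τ * Real.sin θ) with hc
      have hcs : c * Real.sin θ = ρ / τ := by rw [hc]; field_simp
      have hc0 : 0 < c := by positivity
      have := abs_integral_le_of_eq_zero_off_Icc (k := K θ) (a := 0) (b := Real.pi)
        (p := Real.pi / 2 - Real.pi / 2 * c) (q := Real.pi / 2 + Real.pi / 2 * c) hpi.le
        (by nlinarith) hB (fun α _ => hK θ α) (fun α hα hne => by
          refine mem_Icc_of_abs_cos_le hα ?_
          have h1 := (hsupp θ α hne).2
          rw [← mul_assoc, abs_mul, abs_of_pos (by positivity : 0 < τ * Real.sin θ)] at h1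
          rw [hc, le_div_iff₀ (by positivity)]
          linarith)
      calc Real.sin θ * |∫ α in (0 : ℝ)..Real.pi, K θ α|
          ≤ Real.sin θ * (B * (Real.pi / 2 + Real.pi / 2 * c - (Real.pi / 2 - Real.pi / 2 * c))) :=
            mul_le_mul_of_nonneg_left this h0.le
        _ = B * (Real.pi * (c * Real.sin θ)) := by ring
        _ = _ := by rw [hcs]; ring
  have outer := abs_integral_le_of_eq_zero_off_Icc
    (k := fun θ => ∫ α in (0 : ℝ)..Real.pi, Real.sin θ * K θ α) (a := 0) (b := Real.pi)
    (p := Real.arccos a - 2 * Real.pi * ρ / √D) (q := Real.arccos a) (B := B * (Real.pi * ρ / τ))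
    hpi.le (by have : 0 ≤ 2 * Real.pi * ρ / √D := by positivity
               linarith) (by positivity) inner (fun θ hθ hne => by
      have : ∃ α, K θ α ≠ 0 := by
        by_contra! hall
        exact hne (by simp [hall])
      obtain ⟨α, hα⟩ := this
      have h1 := abs_le.1 (hsupp θ α hα).1
      have hcos : a ≤ Real.cos θ := by rw [ha, div_le_iff₀ hτ0]; linarith [h1.1]
      have hle : θ ≤ Real.arccos a := by
        rw [← Real.arccos_cos hθ.1 hθ.2]
        exact Real.arccos_le_arccos hcos
      refine ⟨?_, hle⟩
      -- On the support `cos θ - a` is at most `2 * ρ / τ`, which confines `θ` to a window below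
      -- `Real.arccos a`.
      have h2 := sin_mul_sub_le_pi_mul_cos_sub_cos hθ.1 hle (Real.arccos_le_pi a)
      rw [Real.cos_arccos ha2.le ha1.le] at h2
      have h3 := mul_le_mul_of_nonneg_left h2 hτ0.le
      have h4 : √D * (Real.arccos a - θ) ≤ 2 * Real.pi * ρ := by
        calc √D * (Real.arccos a - θ)
            = τ * (Real.sin (Real.arccos a) * (Real.arccos a - θ)) := by rw [← hsin]; ring
          _ ≤ τ * (Real.pi * (Real.cos θ - a)) := h3
          _ = Real.pi * (τ * Real.cos θ - a * τ) := by ring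
          _ ≤ Real.pi * (2 * ρ) := by
            rw [haτ]; exact mul_le_mul_of_nonneg_left (by linarith [h1.2]) hpi.le
          _ = _ := by ring
      have h5 : Real.arccos a - θ ≤ 2 * Real.pi * ρ / √D := by
        rw [le_div_iff₀ hsD]; linarith
      linarith)
  refine outer.trans_eq ?_
  ring

end SphereMeasure

/-! ### Waves in the plane: finite speed of propagation and decay. -/

section Wave

variable {E : Type*} [NormedAddCommGroup E] [NormedSpace ℝ E]

/-- This and the next three lemmas translate the separate time and space derivatives in `waveOp` and
`timeDeriv` into joint derivatives on `ℝ × E`. -/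
theorem hasDerivAt_slice_time {Φ : ℝ × E → ℝ} {Φ₁ : ℝ × E → ℝ × E →L[ℝ] ℝ}
    (hd : ∀ p, HasFDerivAt Φ (Φ₁ p) p) (t : ℝ) (x : E) :
    HasDerivAt (fun s => Φ (s, x)) (Φ₁ (t, x) (1, 0)) t :=
  (hd (t, x)).comp_hasDerivAt t ((hasDerivAt_id t).prodMk (hasDerivAt_const t x))

theorem iteratedDeriv_two_slice_time {Φ : ℝ × E → ℝ} {Φ₁ : ℝ × E → ℝ × E →L[ℝ] ℝ}
    {Φ₂ : ℝ × E → ℝ × E →L[ℝ] ℝ × E →L[ℝ] ℝ} (hd : ∀ p, HasFDerivAt Φ (Φ₁ p) p)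
    (hd₁ : ∀ p, HasFDerivAt Φ₁ (Φ₂ p) p) (t : ℝ) (x : E) :
    iteratedDeriv 2 (fun s => Φ (s, x)) t = Φ₂ (t, x) (1, 0) (1, 0) := by
  rw [iteratedDeriv_succ, iteratedDeriv_one]
  have : deriv (fun s => Φ (s, x)) = fun s => Φ₁ (s, x) (1, 0) :=
    funext fun s => (hasDerivAt_slice_time hd s x).deriv
  rw [this]
  have h := HasDerivAt.clm_comp_apply hd₁ ((hasDerivAt_id t).prodMk (hasDerivAt_const t x))
    (hasDerivAt_const t ((1 : ℝ), (0 : E)))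
  simpa using h.deriv

theorem fderiv_slice_space {Φ : ℝ × E → ℝ} {Φ₁ : ℝ × E → ℝ × E →L[ℝ] ℝ}
    (hd : ∀ p, HasFDerivAt Φ (Φ₁ p) p) (t : ℝ) (x v : E) :
    fderiv ℝ (fun y => Φ (t, y)) x v = Φ₁ (t, x) (0, v) := by
  have := ((hd (t, x)).comp x (hasFDerivAt_prodMk_right t x)).fderiv
  change fderiv ℝ (Φ ∘ fun y => (t, y)) x v = _
  rw [this]
  simp

theorem iteratedFDeriv_two_slice_space {Φ : ℝ × E → ℝ} {Φ₁ : ℝ × E → ℝ × E →L[ℝ] ℝ}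
    {Φ₂ : ℝ × E → ℝ × E →L[ℝ] ℝ × E →L[ℝ] ℝ} (hd : ∀ p, HasFDerivAt Φ (Φ₁ p) p)
    (hd₁ : ∀ p, HasFDerivAt Φ₁ (Φ₂ p) p) (t : ℝ) (x v w : E) :
    iteratedFDeriv ℝ 2 (fun y => Φ (t, y)) x ![v, w] = Φ₂ (t, x) (0, v) (0, w) := by
  rw [iteratedFDeriv_two_apply]
  have h1 : fderiv ℝ (fun y => Φ (t, y)) =
      fun y => (Φ₁ (t, y)).comp (ContinuousLinearMap.inr ℝ ℝ E) := by
    ext y v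
    simp [fderiv_slice_space hd]
  rw [h1]
  have h2 := (((hd₁ (t, x)).comp x (hasFDerivAt_prodMk_right t x)).clm_comp
    (hasFDerivAt_const (ContinuousLinearMap.inr ℝ ℝ E) x)).fderiv
  simp only [Function.comp_def] at h2
  rw [h2]
  simp

/-- Every vector of the plane is a nonpositive multiple of the first vector of some orthonormal
basis. -/
theorem exists_orthonormalBasis_eq_neg_norm_smul (x : Plane) :
    ∃ b : OrthonormalBasis (Fin 2) ℝ Plane, x = -(‖x‖ • b 0) := by
  by_cases hx : x = 0
  · exact ⟨EuclideanSpace.basisFun (Fin 2) ℝ, by simp [hx]⟩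
  · have hn : ‖x‖ ≠ 0 := norm_ne_zero_iff.2 hx
    have ho : Orthonormal ℝ (({0} : Set (Fin 2)).domRestrict fun _ => -(‖x‖⁻¹ • x)) := by
      refine ⟨fun i => ?_, fun i j hij => absurd (Subsingleton.elim i j) hij⟩
      simp [Set.domRestrict, norm_smul, hn]
    obtain ⟨b, hb⟩ := ho.exists_orthonormalBasis_extension_of_card_eq (by simp)
    refine ⟨b, ?_⟩
    rw [hb 0 rfl, smul_neg, neg_neg, smul_smul, mul_inv_cancel₀ hn, one_smul]

theorem inner_diskPoint_left {F : Type*} [NormedAddCommGroup F] [InnerProductSpace ℝ F]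
    (b : OrthonormalBasis (Fin 2) ℝ F) (θ α : ℝ) :
    inner ℝ (b 0) (diskPoint (b 0) (b 1) θ α) = Real.cos θ ∧
      inner ℝ (b 1) (diskPoint (b 0) (b 1) θ α) = Real.sin θ * Real.cos α := by
  have h01 : inner ℝ (b 0) (b 1) = 0 := b.orthonormal.2 (by decide)
  have h10 : inner ℝ (b 1) (b 0) = 0 := b.orthonormal.2 (by decide)
  simp [diskPoint, inner_add_right, inner_smul_right, h01, h10]

theorem norm_diskPoint_le_one {F : Type*} [NormedAddCommGroup F] [InnerProductSpace ℝ F]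
    (b : OrthonormalBasis (Fin 2) ℝ F) (θ α : ℝ) : ‖diskPoint (b 0) (b 1) θ α‖ ≤ 1 := by
  have h := b.sum_sq_norm_inner_right (diskPoint (b 0) (b 1) θ α)
  rw [Fin.sum_univ_two, (inner_diskPoint_left b θ α).1, (inner_diskPoint_left b θ α).2] at h
  simp only [Real.norm_eq_abs, sq_abs] at h
  have h1 := Real.sin_sq_add_cos_sq θ
  have h2 := Real.cos_sq_le_one α
  have h3 : ‖diskPoint (b 0) (b 1) θ α‖ ^ 2 ≤ 1 := by
    rw [← h]
    nlinarith [sq_nonneg (Real.sin θ)]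
  exact (sq_le_one_iff₀ (norm_nonneg _)).1 h3

/-- Kirchhoff's formula for solutions of the wave equation in the plane. -/
theorem IsLinearWave.kirchhoff {φ : ℝ → Plane → ℝ} (hφ : IsLinearWave φ)
    (b : OrthonormalBasis (Fin 2) ℝ Plane) (t₀ t : ℝ) (x : Plane) :
    2 * Real.pi * φ t x =
      ∫ θ in (0 : ℝ)..Real.pi, ∫ α in (0 : ℝ)..Real.pi, Real.sin θ *
        (φ t₀ (x + (t - t₀) • diskPoint (b 0) (b 1) θ α) +
          (t - t₀) * (timeDeriv φ t₀ (x + (t - t₀) • diskPoint (b 0) (b 1) θ α) +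
            fderiv ℝ (φ t₀) (x + (t - t₀) • diskPoint (b 0) (b 1) θ α)
              (diskPoint (b 0) (b 1) θ α))) := by
  set Φ : ℝ × Plane → ℝ := fun p => φ p.1 p.2 with hΦ
  have hC : ContDiff ℝ 2 Φ := hφ.contDiff
  have hC₁ : ContDiff ℝ 1 (fderiv ℝ Φ) := hC.fderiv_right (by norm_num)
  have hd : ∀ p, HasFDerivAt Φ (fderiv ℝ Φ p) p := fun p =>
    (hC.differentiable two_ne_zero p).hasFDerivAt
  have hd₁ : ∀ p, HasFDerivAt (fderiv ℝ Φ) (fderiv ℝ (fderiv ℝ Φ) p) p := fun p =>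
    (hC₁.differentiable one_ne_zero p).hasFDerivAt
  have hsymm : ∀ p v w, fderiv ℝ (fderiv ℝ Φ) p v w = fderiv ℝ (fderiv ℝ Φ) p w v := fun p v w =>
    hC.contDiffAt.isSymmSndFDerivAt (by simp) v w
  have hwave : ∀ p, fderiv ℝ (fderiv ℝ Φ) p (1, 0) (1, 0) =
      fderiv ℝ (fderiv ℝ Φ) p (0, b 0) (0, b 0) + fderiv ℝ (fderiv ℝ Φ) p (0, b 1) (0, b 1) := by
    rintro ⟨s, y⟩
    have h := hφ.waveOp_eq_zero s y
    rw [waveOp, InnerProductSpace.laplacian_eq_iteratedFDeriv_orthonormalBasis _ b] at h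
    simp only [Fin.sum_univ_two] at h
    have e1 := iteratedDeriv_two_slice_time hd hd₁ s y
    have e2 := fun v => iteratedFDeriv_two_slice_space hd hd₁ s y v v
    simp only [hΦ] at e1 e2
    rw [e1, e2, e2] at h
    linarith
  have key := kirchhoff_of_wave hd hd₁ (hC₁.continuous_fderiv one_ne_zero) hsymm (b 0) (b 1) hwave
    t (t - t₀) x
  rw [sub_sub_cancel] at key
  rw [show φ t x = Φ (t, x) from rfl, key]
  congr! 7 with θ α
  have e1 : ∀ y, timeDeriv φ t₀ y = fderiv ℝ Φ (t₀, y) (1, 0) := fun y =>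
    (hasDerivAt_slice_time hd t₀ y).deriv
  have e2 : ∀ y v, fderiv ℝ (φ t₀) y v = fderiv ℝ Φ (t₀, y) (0, v) := fun y v =>
    fderiv_slice_space hd t₀ y v
  rw [e1, e2, ← map_add]
  simp

/-- Finite speed of propagation. -/
theorem IsLinearWave.eq_zero_of_lt_norm {φ : ℝ → Plane → ℝ} (hφ : IsLinearWave φ) {t₀ R : ℝ}
    (hf : Function.support (φ t₀) ⊆ Metric.closedBall 0 R)
    (hg : Function.support (timeDeriv φ t₀) ⊆ Metric.closedBall 0 R) {t : ℝ} {x : Plane}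
    (ht : t₀ ≤ t) (hx : R + (t - t₀) < ‖x‖) : φ t x = 0 := by
  have key := hφ.kirchhoff (EuclideanSpace.basisFun (Fin 2) ℝ) t₀ t x
  have hfar : ∀ θ α, R < ‖x + (t - t₀) • diskPoint (EuclideanSpace.basisFun (Fin 2) ℝ 0)
      (EuclideanSpace.basisFun (Fin 2) ℝ 1) θ α‖ := by
    intro θ α
    have h1 := norm_diskPoint_le_one (EuclideanSpace.basisFun (Fin 2) ℝ) θ α
    have h2 := norm_sub_le_norm_add x ((t - t₀) • diskPoint (EuclideanSpace.basisFun (Fin 2) ℝ 0)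
      (EuclideanSpace.basisFun (Fin 2) ℝ 1) θ α)
    rw [norm_smul, Real.norm_of_nonneg (sub_nonneg.2 ht)] at h2
    nlinarith [mul_le_mul_of_nonneg_left h1 (sub_nonneg.2 ht)]
  have hz : ∀ {h : Plane → ℝ}, Function.support h ⊆ Metric.closedBall 0 R → ∀ {y}, R < ‖y‖ →
      h y = 0 := fun hs y hy => by
    by_contra hne
    exact absurd (mem_closedBall_zero_iff.1 (hs hne)) (not_le.2 hy)
  simp only [hz hf (hfar _ _), hz hg (hfar _ _),
    fderiv_eq_zero_of_support_subset_closedBall hf (hfar _ _), zero_apply, add_zero, mul_zero,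
    intervalIntegral.integral_zero] at key
  simpa [Real.pi_ne_zero] using key

/-- The decay estimate for data supported in a ball of radius `ρ ≥ max 1 |t₀|`. -/
theorem IsLinearWave.abs_le_div_sqrt {φ : ℝ → Plane → ℝ} (hφ : IsLinearWave φ) {t₀ ρ : ℝ}
    (hρ : 1 ≤ ρ) (ht₀ : |t₀| ≤ ρ) (hf3 : ContDiff ℝ 3 (φ t₀)) (hg2 : ContDiff ℝ 2 (timeDeriv φ t₀))
    (hf : Function.support (φ t₀) ⊆ Metric.closedBall 0 ρ)
    (hg : Function.support (timeDeriv φ t₀) ⊆ Metric.closedBall 0 ρ) {t : ℝ} {x : Plane}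
    (ht : t₀ ≤ t) (hx : ‖x‖ < t) :
    |φ t x| ≤ 50 * ρ ^ 2 * √(volume.real (Metric.closedBall (0 : Plane) ρ)) *
      (sobolevNorm 3 (φ t₀) + sobolevNorm 2 (timeDeriv φ t₀)) /
        √((t + ‖x‖) * (t - ‖x‖)) := by
  -- The sign makes `b 0` point from `x` towards the origin, so the support of the data is seen
  -- around the polar axis, at distance `r`.
  obtain ⟨b, hb⟩ := exists_orthonormalBasis_eq_neg_norm_smul x
  have key := hφ.kirchhoff b t₀ t x
  set r := ‖x‖ with hr
  have hr0 : 0 ≤ r := norm_nonneg x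
  set τ := t - t₀ with hτ
  have hτ0 : 0 ≤ τ := sub_nonneg.2 ht
  set S := √(volume.real (Metric.closedBall (0 : Plane) ρ)) with hS
  have hS0 : 0 ≤ S := Real.sqrt_nonneg _
  set s₃ := sobolevNorm 3 (φ t₀) with hs₃
  set s₂ := sobolevNorm 2 (timeDeriv φ t₀) with hs₂
  have hs₃0 : 0 ≤ s₃ := Real.sqrt_nonneg _
  have hs₂0 : 0 ≤ s₂ := Real.sqrt_nonneg _
  set K : ℝ → ℝ → ℝ := fun θ α => φ t₀ (x + τ • diskPoint (b 0) (b 1) θ α) +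
    τ * (timeDeriv φ t₀ (x + τ • diskPoint (b 0) (b 1) θ α) +
      fderiv ℝ (φ t₀) (x + τ • diskPoint (b 0) (b 1) θ α) (diskPoint (b 0) (b 1) θ α)) with hKdef
  set B := S * (1 + τ) * (s₃ + s₂) with hB
  have hB0 : 0 ≤ B := by positivity
  have hK : ∀ θ α, |K θ α| ≤ B := by
    intro θ α
    have h1 := abs_le_sobolevNorm (k := 3) (by norm_num) (hf3.of_le (by norm_num)) hf
      (x + τ • diskPoint (b 0) (b 1) θ α)
    have h2 := abs_le_sobolevNorm (k := 2) le_rfl hg2 hg (x + τ • diskPoint (b 0) (b 1) θ α)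
    have h3 := norm_fderiv_le_sobolevNorm (k := 3) le_rfl hf3 hf
      (x + τ • diskPoint (b 0) (b 1) θ α)
    have h4 := (fderiv ℝ (φ t₀) (x + τ • diskPoint (b 0) (b 1) θ α)).le_of_opNorm_le_of_le h3
      (norm_diskPoint_le_one b θ α)
    rw [mul_one, Real.norm_eq_abs] at h4
    calc |K θ α| ≤ S * s₃ + τ * (S * s₂ + S * s₃) := by
          refine (abs_add_le _ _).trans (add_le_add h1 ?_)
          rw [abs_mul, abs_of_nonneg hτ0]
          exact mul_le_mul_of_nonneg_left ((abs_add_le _ _).trans (add_le_add h2 h4)) hτ0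
      _ ≤ B := by
        have : 0 ≤ S * s₂ := by positivity
        rw [hB]; linarith
  have hcoord : ∀ θ α, K θ α ≠ 0 →
      |τ * Real.cos θ - r| ≤ ρ ∧ |τ * (Real.sin θ * Real.cos α)| ≤ ρ := by
    intro θ α hne
    have hmem : ‖x + τ • diskPoint (b 0) (b 1) θ α‖ ≤ ρ := by
      by_contra! hgt
      have hz : ∀ {h : Plane → ℝ}, Function.support h ⊆ Metric.closedBall 0 ρ →
          h (x + τ • diskPoint (b 0) (b 1) θ α) = 0 := fun hs => by
        by_contra hne
        exact absurd (mem_closedBall_zero_iff.1 (hs hne)) (not_le.2 hgt)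
      apply hne
      simp [hKdef, hz hf, hz hg, fderiv_eq_zero_of_support_subset_closedBall hf hgt]
    have hi : ∀ i, |inner ℝ (b i) (x + τ • diskPoint (b 0) (b 1) θ α)| ≤ ρ := fun i => by
      refine (abs_real_inner_le_norm _ _).trans ?_
      rwa [b.norm_eq_one, one_mul]
    have hx0 : inner ℝ (b 0) x = -r := by
      rw [hb, inner_neg_right, inner_smul_right, real_inner_self_eq_norm_sq, b.norm_eq_one]; simp
    have hx1 : inner ℝ (b 1) x = 0 := by
      have : inner ℝ (b 1) (b 0) = 0 := b.orthonormal.2 (by decide)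
      rw [hb, inner_neg_right, inner_smul_right, this]; simp
    have h0 := hi 0
    have h1 := hi 1
    rw [inner_add_right, inner_smul_right, (inner_diskPoint_left b θ α).1, hx0] at h0
    rw [inner_add_right, inner_smul_right, (inner_diskPoint_left b θ α).2, hx1, zero_add] at h1
    exact ⟨by rwa [sub_eq_neg_add], h1⟩
  have hpi := Real.pi_pos
  have hφle : |φ t x| = (2 * Real.pi)⁻¹ *
      |∫ θ in (0 : ℝ)..Real.pi, ∫ α in (0 : ℝ)..Real.pi, Real.sin θ * K θ α| := by
    rw [← key, abs_mul, abs_of_pos (by positivity : 0 < 2 * Real.pi)]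
    field_simp
  obtain ⟨ht₀1, ht₀2⟩ := abs_le.1 ht₀
  have hpos : 0 < (t + r) * (t - r) := mul_pos (by linarith) (by linarith)
  set Q := √((t + r) * (t - r)) with hQ
  have hQ0 : 0 < Q := Real.sqrt_pos.2 hpos
  rw [hφle, le_div_iff₀ hQ0]
  -- For bounded `τ` the trivial bound on the integral suffices, since `Q ≤ t ≤ 5 * ρ`; this case
  -- fixes the constant 50. The large case needs only 16.
  rcases lt_or_ge τ (4 * ρ) with hlt | hge
  · have hQle : Q ≤ 5 * ρ := by
      rw [hQ]
      refine (Real.sqrt_le_left (by positivity)).2 ?_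
      nlinarith [sq_nonneg r]
    have hI : |∫ θ in (0 : ℝ)..Real.pi, ∫ α in (0 : ℝ)..Real.pi, Real.sin θ * K θ α| ≤
        B * Real.pi * Real.pi := by
      have := intervalIntegral.norm_integral_le_of_norm_le_const (a := 0) (b := Real.pi)
        (f := fun θ => ∫ α in (0 : ℝ)..Real.pi, Real.sin θ * K θ α) (C := B * Real.pi)
        fun θ _ => by
          have := intervalIntegral.norm_integral_le_of_norm_le_const (a := 0) (b := Real.pi)
            (f := fun α => Real.sin θ * K θ α) (C := B) fun α _ => by
              rw [norm_mul]
              exact (mul_le_mul (Real.abs_sin_le_one θ) (hK θ α) (abs_nonneg _)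
                zero_le_one).trans_eq (one_mul B)
          rwa [sub_zero, abs_of_pos hpi] at this
      rwa [sub_zero, abs_of_pos hpi] at this
    calc (2 * Real.pi)⁻¹ *
        |∫ θ in (0 : ℝ)..Real.pi, ∫ α in (0 : ℝ)..Real.pi, Real.sin θ * K θ α| * Q
        ≤ (2 * Real.pi)⁻¹ * (B * Real.pi * Real.pi) * (5 * ρ) := by gcongr
      _ = B * Real.pi * (5 / 2 * ρ) := by field_simp
      _ ≤ (S * (5 * ρ) * (s₃ + s₂)) * 4 * (5 / 2 * ρ) := by
        rw [hB]
        gcongr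
        · linarith
        · exact Real.pi_le_four
      _ = 50 * ρ ^ 2 * S * (s₃ + s₂) := by ring
  · have hI := abs_sphere_integral_le hB0 (by linarith) (by linarith) hr0
      (by linarith : 0 < τ - r + ρ) hK hcoord
    set D := (τ - r + ρ) * (τ + r - ρ) with hD
    have hD0 : 0 < D := mul_pos (by linarith) (by linarith)
    have hQD : Q ≤ 2 * √D := by
      have : √(4 * D) = 2 * √D := by
        rw [Real.sqrt_mul (by norm_num), show (4 : ℝ) = 2 ^ 2 by norm_num,
          Real.sqrt_sq (by norm_num)]
      rw [← this]
      refine Real.sqrt_le_sqrt ?_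
      have h1 : t - r ≤ τ - r + ρ := by linarith
      have h2 : t + r ≤ 4 * (τ + r - ρ) := by linarith
      calc (t + r) * (t - r) ≤ 4 * (τ + r - ρ) * (τ - r + ρ) :=
            mul_le_mul h2 h1 (by linarith) (by linarith)
        _ = 4 * D := by rw [hD]; ring
    have hsD : 0 < √D := Real.sqrt_pos.2 hD0
    have hτ1 : 0 < τ := by linarith
    calc (2 * Real.pi)⁻¹ *
        |∫ θ in (0 : ℝ)..Real.pi, ∫ α in (0 : ℝ)..Real.pi, Real.sin θ * K θ α| * Q
        ≤ (2 * Real.pi)⁻¹ * (B * (Real.pi * ρ / τ) * (2 * Real.pi * ρ / √D)) * (2 * √D) := by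
          gcongr
      _ = ρ ^ 2 * S * (s₃ + s₂) * (2 * Real.pi * ((1 + τ) / τ)) := by rw [hB]; field_simp
      _ ≤ ρ ^ 2 * S * (s₃ + s₂) * (2 * 4 * 2) := by
        have h2 : (1 + τ) / τ ≤ 2 := by rw [div_le_iff₀ hτ1]; linarith
        gcongr
        exact Real.pi_le_four
      _ ≤ 50 * ρ ^ 2 * S * (s₃ + s₂) := by
        have : 0 ≤ ρ ^ 2 * S * (s₃ + s₂) := by positivity
        linarith

end Wave

/-! ### The final estimate, with the logarithm inserted. -/

theorem mainTheorem4 (t₀ R δ : ℝ) (hδ : 1 < δ) :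
    ∃ C : ℝ, 0 < C ∧ ∀ φ : ℝ → Plane → ℝ,
      IsLinearWave φ →
      ContDiff ℝ 3 (φ t₀) →
      ContDiff ℝ 2 (timeDeriv φ t₀) →
      Function.support (φ t₀) ⊆ Metric.closedBall 0 R →
      Function.support (timeDeriv φ t₀) ⊆ Metric.closedBall 0 R →
      (∀ t : ℝ, ∀ x : Plane, t₀ ≤ t → R + (t - t₀) < ‖x‖ → φ t x = 0) ∧
      (∀ t : ℝ, ∀ x : Plane, t₀ ≤ t → ‖x‖ < t → δ ≤ (t + ‖x‖) * (t - ‖x‖) →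
        |φ t x| ≤ C * (sobolevNorm 3 (φ t₀) + sobolevNorm 2 (timeDeriv φ t₀)) *
          (Real.log ((t + ‖x‖) * (t - ‖x‖)) / Real.sqrt ((t + ‖x‖) * (t - ‖x‖)))) := by
  have hlog : 0 < Real.log δ := Real.log_pos hδ
  set ρ := |R| + |t₀| + 1 with hρ
  have hR := abs_nonneg R
  have ht := abs_nonneg t₀
  set S := √(volume.real (Metric.closedBall (0 : Plane) ρ)) with hS
  have hS0 : 0 ≤ S := Real.sqrt_nonneg _
  have hρ0 : 0 < ρ := by positivity
  -- Using `S + 1` instead of `S` makes positivity immediate; dividing by `Real.log δ` pays for the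
  -- factor `Real.log q`.
  refine ⟨50 * ρ ^ 2 * (S + 1) / Real.log δ, by positivity, fun φ hφ hf3 hg2 hf hg =>
    ⟨fun t x htt hx => hφ.eq_zero_of_lt_norm hf hg htt hx, fun t x htt hx hδx => ?_⟩⟩
  have hball : Metric.closedBall (0 : Plane) R ⊆ Metric.closedBall 0 ρ :=
    Metric.closedBall_subset_closedBall (by linarith [le_abs_self R])
  refine (hφ.abs_le_div_sqrt (ρ := ρ) (by linarith) (by linarith) hf3 hg2 (hf.trans hball)
    (hg.trans hball) htt hx).trans ?_
  have hN : 0 ≤ sobolevNorm 3 (φ t₀) + sobolevNorm 2 (timeDeriv φ t₀) :=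
    add_nonneg (Real.sqrt_nonneg _) (Real.sqrt_nonneg _)
  set N := sobolevNorm 3 (φ t₀) + sobolevNorm 2 (timeDeriv φ t₀)
  set q := (t + ‖x‖) * (t - ‖x‖)
  have hlq : 1 ≤ Real.log q / Real.log δ := by
    rw [one_le_div hlog]
    exact Real.log_le_log (by linarith) hδx
  calc 50 * ρ ^ 2 * S * N / √q ≤ 50 * ρ ^ 2 * (S + 1) * N / √q * 1 := by
        rw [mul_one]; gcongr; linarith
    _ ≤ 50 * ρ ^ 2 * (S + 1) * N / √q * (Real.log q / Real.log δ) := by gcongr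
    _ = _ := by ring
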